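/- **Setting.** Let $m\ge 2$ be an integer, $I=[0,1]$ with its Borel $\sigma$-algebra $\mathcal B_I$ and the metric $|x-y|$, and $\mathbf N=\{0,1,2,\dots\}$ with all its subsets. For $i\in\mathbf N$ put $$u_i(x)=\frac{m^{-i}}{1+(m-1)x}\quad(x\in I),\qquad P_i(y)=\frac{(m-1)m^{-(i+1)}(y+1)(y+m)}{(y+(m-1)m^{-i}+1)(y+(m-1)m^{-(i+1)}+1)}\quad(y\ge 0).$$ Let $u(x,i)=u_i(x)$, and let the transition probabilities be either $P(x,i)=P_i(x)$ for all $x,i$, or $P(x,i)=P_i((m-1)x)$ for all $x,i$; the result holds for both choices. Consider the random system with complete connections (RSCC) $((I,\mathcal B_I),(\mathbf N,\mathcal P(\mathbf N)),u,P)$ and its associated Markov operator $$U_mf(x)=\sum_{i\in\mathbf N}P(x,i)\,f(u_i(x))=\int_I f(y)\,Q_m(x,dy),\qquad Q_m(x,A)=\sum_{i:\,u_i(x)\in A}P(x,i).$$ Let $L(I)$ be the space of real Lipschitz functions on $I$ with the norm $\|f\|_L=\sup_x|f(x)|+\sup_{x'\ne x''}\frac{|f(x')-f(x'')|}{|x'-x''|}$.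 For a word $i_1\dots i_k$ write $x i_1\dots i_k=u_{i_k}(\cdots u_{i_1}(x)\cdots)$ and $P_k(x,i_1\dots i_k)=\prod_{j=1}^kP(x i_1\dots i_{j-1},i_j)$. An RSCC on $I$ is *with contraction* if $r_1<\infty$, $R_1<\infty$ and $r_k<1$ for some $k\ge1$, where $$r_k=\sup_{x'\ne x''}\sum_{w\in\mathbf N^k}P_k(x',w)\frac{|x'w-x''w|}{|x'-x''|},\qquad R_1=\sup_{A\subset\mathbf N}\ \sup_{x'\ne x''}\frac{|P(x',A)-P(x'',A)|}{|x'-x''|},\qquad P(x,A)=\sum_{i\in A}P(x,i).$$ An operator $U$ is *regular with respect to $L(I)$* if it restricts to a bounded linear operator on $L(I)$ and there is a bounded linear operator $U^\infty$ on $L(I)$ with one-dimensional range such that $\|U^n-U^\infty\|\to0$ in the operator norm on $(L(I),\|\cdot\|_L)$. **Proposition 4.2.** The RSCC above is an RSCC with contraction, and $U_m$ is regular with respect to $L(I)$. Moreover, there are a probability measure $Q^\infty_m$ on $\mathcal B_I$ and constants $0<q<1$ and $k>0$ such that $$\Big\|U_m^nf-\int_I f\,dQ^\infty_m\Big\|_L\le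 k\,q^n\,\|f\|_L\qquad\text{for all } n\ge1,\ f\in L(I).$$ -/

import Mathlib

open MeasureTheory ProbabilityTheory Filter Topology
open scoped NNReal ENNReal unitInterval

/-- A (homogeneous) random system with complete connections `((W, 𝒲), (X, 𝒳), u, P)`: a measurable
map `u : W × X → W` and a transition probability function `P` from `W` to `X`. -/
structure RSCC (W X : Type*) [MeasurableSpace W] [MeasurableSpace X] where
  /-- the state update map -/
  u : W × X → W
  measurable_u : Measurable u
  /-- the transition probability function -/
  P : Kernel W X
  isMarkov : IsMarkovKernel P

namespace RSCC

section General

variable {W X : Type*} [MeasurableSpace W] [MeasurableSpace X]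

/-- `w x₁ … x_k`: the state reached from `w` after reading the letters `x₁, …, x_k` in this order,
`w x₁ … x_k = u (w x₁ … x_{k-1}, x_k)`. -/
def act (R : RSCC W X) : (k : ℕ) → W → (Fin k → X) → W
  | 0, w, _ => w
  | k + 1, w, x => R.act k (R.u (w, x 0)) (Fin.tail x)

theorem measurable_cons (k : ℕ) :
    Measurable fun p : X × (Fin k → X) => (Fin.cons p.1 p.2 : Fin (k + 1) → X) := by
  refine measurable_pi_iff.2 fun i => ?_
  refine Fin.cases ?_ (fun j => ?_) i
  · exact measurable_fst
  · exact (measurable_pi_apply j).comp measurable_snd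

/-- The transition probability functions `P_k` from `W` to `X^k`:
`P_k(w, A) = ∫ P(w, dx₁) ∫ P(w x₁, dx₂) … ∫ P(w x₁ … x_{k-1}, dx_k) 1_A(x₁, …, x_k)`. -/
noncomputable def wordKernel (R : RSCC W X) : (k : ℕ) → Kernel W (Fin k → X)
  | 0 => Kernel.const W (Measure.dirac Fin.elim0)
  | k + 1 =>
      (R.P ⊗ₖ (R.wordKernel k).comap R.u R.measurable_u).map
        (fun p => (Fin.cons p.1 p.2 : Fin (k + 1) → X))

/-- The transition probability function of the associated Markov chain,
`Q(w, B) = P(w, {x : u(w, x) ∈ B})`. -/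
noncomputable def Q (R : RSCC W X) : Kernel W W :=
  (Kernel.id ×ₖ R.P).map R.u

/-- The associated Markov operator, `U f (w) = ∫ f(y) Q(w, dy)`. -/
noncomputable def U (R : RSCC W X) (f : W → ℝ) : W → ℝ :=
  fun w => ∫ y, f y ∂(R.Q w)

end General

section Contraction

variable {W X : Type*} [MetricSpace W] [MeasurableSpace W] [MeasurableSpace X]

/-- `r_k = sup_{w' ≠ w''} ∫ P_k(w', dx) d(w' x, w'' x) / d(w', w'')`, where `x` runs over `X^k`. -/
noncomputable def r (R : RSCC W X) (k : ℕ) : ℝ≥0∞ :=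
  ⨆ (w' : W) (w'' : W) (_ : w' ≠ w''),
    (∫⁻ x, edist (R.act k w' x) (R.act k w'' x) ∂(R.wordKernel k w')) / edist w' w''

/-- `R₁ = sup_A sup_{w' ≠ w''} |P(w', A) - P(w'', A)| / d(w', w'')`, where `A` runs over the
measurable subsets of `X`. -/
noncomputable def R₁ (R : RSCC W X) : ℝ≥0∞ :=
  ⨆ (A : Set X) (_ : MeasurableSet A) (w' : W) (w'' : W) (_ : w' ≠ w''),
    ENNReal.ofReal |(R.P w').real A - (R.P w'').real A| / edist w' w''

/-- An RSCC over a separable metric space (with its Borel sets) is an RSCC with contraction if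
`r₁ < ∞`, `R₁ < ∞` and `r_k < 1` for some `k ≥ 1`. -/
def IsWithContraction [TopologicalSpace.SeparableSpace W] [BorelSpace W] (R : RSCC W X) : Prop :=
  R.r 1 < ∞ ∧ R.R₁ < ∞ ∧ ∃ k : ℕ, 1 ≤ k ∧ R.r k < 1

end Contraction

end RSCC

section Lipschitz

variable {W : Type*} [MetricSpace W]

/-- `‖f‖_L = sup |f| + sup_{x ≠ y} |f x - f y| / d(x, y)`, with values in `[0, ∞]`; it is finite
exactly for the bounded Lipschitz functions. -/
noncomputable def lipNorm (f : W → ℝ) : ℝ≥0∞ :=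
  (⨆ x, ‖f x‖ₑ) + ⨆ (x : W) (y : W) (_ : x ≠ y), edist (f x) (f y) / edist x y

theorem edist_div_le_iSup (f : W → ℝ) {x y : W} (h : x ≠ y) :
    edist (f x) (f y) / edist x y ≤
      ⨆ (x : W) (y : W) (_ : x ≠ y), edist (f x) (f y) / edist x y := by
  refine le_trans ?_ (le_iSup _ x)
  refine le_trans ?_ (le_iSup _ y)
  exact le_iSup (fun _ : x ≠ y => edist (f x) (f y) / edist x y) h

theorem lipNorm_add_le (f g : W → ℝ) : lipNorm (f + g) ≤ lipNorm f + lipNorm g := by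
  unfold lipNorm
  rw [add_add_add_comm]
  gcongr
  · refine iSup_le fun x => (enorm_add_le _ _).trans ?_
    exact add_le_add (le_iSup (fun x => ‖f x‖ₑ) x) (le_iSup (fun x => ‖g x‖ₑ) x)
  · refine iSup_le fun x => iSup_le fun y => iSup_le fun h => ?_
    calc edist ((f + g) x) ((f + g) y) / edist x y
        ≤ (edist (f x) (f y) + edist (g x) (g y)) / edist x y := by
          gcongr; exact edist_add_add_le _ _ _ _
      _ = edist (f x) (f y) / edist x y + edist (g x) (g y) / edist x y := ENNReal.add_div
      _ ≤ _ := add_le_add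
          (edist_div_le_iSup f h) (edist_div_le_iSup g h)

theorem lipNorm_smul_le (c : ℝ) (f : W → ℝ) : lipNorm (c • f) ≤ ‖c‖ₑ * lipNorm f := by
  unfold lipNorm
  rw [mul_add]
  gcongr
  · refine iSup_le fun x => ?_
    rw [Pi.smul_apply, smul_eq_mul, enorm_mul]
    gcongr
    exact le_iSup (fun x => ‖f x‖ₑ) x
  · refine iSup_le fun x => iSup_le fun y => iSup_le fun h => ?_
    rw [Pi.smul_apply, Pi.smul_apply, edist_smul₀, ENNReal.smul_def, smul_eq_mul, mul_div_assoc]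
    refine mul_le_mul_right (edist_div_le_iSup f h) _

variable (W) in
/-- `L(W)`: the space of bounded real-valued Lipschitz functions on `W`. -/
def lipSpace : Submodule ℝ (W → ℝ) where
  carrier := {f | lipNorm f < ∞}
  zero_mem' := by simp [lipNorm]
  add_mem' := fun {f g} hf hg =>
    (lipNorm_add_le f g).trans_lt (ENNReal.add_lt_top.2 ⟨hf, hg⟩)
  smul_mem' := fun c f hf =>
    (lipNorm_smul_le c f).trans_lt (ENNReal.mul_lt_top enorm_lt_top hf)

/-- The operator norm, with values in `[0, ∞]`, of a linear operator on `(L(W), ‖·‖_L)`. -/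
noncomputable def lipOpNorm (T : Module.End ℝ (lipSpace W)) : ℝ≥0∞ :=
  ⨆ (f : lipSpace W) (_ : lipNorm (f : W → ℝ) ≤ 1), lipNorm (T f : W → ℝ)

/-- An operator `U` on functions is regular with respect to `L(W)` if it restricts to a bounded
linear operator `T` on `L(W)` and there is a bounded linear operator `V` on `L(W)` with
one-dimensional range such that `‖T ^ n - V‖ → 0`. -/
def IsRegularLip (U : (W → ℝ) → W → ℝ) : Prop :=
  ∃ T : Module.End ℝ (lipSpace W),
    (∀ f : lipSpace W, (T f : W → ℝ) = U f) ∧ lipOpNorm T < ∞ ∧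
    ∃ V : Module.End ℝ (lipSpace W), lipOpNorm V < ∞ ∧
      Tendsto (fun n : ℕ => lipOpNorm (T ^ n - V)) atTop (𝓝 0) ∧
      Module.finrank ℝ (LinearMap.range V) = 1

end Lipschitz

section Chan

/-- `P_i(x) = (m-1) m^{-(i+1)} (x+1)(x+m) / ((x+(m-1)m^{-i}+1)(x+(m-1)m^{-(i+1)}+1))`. -/
noncomputable def chanProb (m i : ℕ) (x : ℝ) : ℝ :=
  (((m : ℝ) - 1) * ((m : ℝ) ^ (i + 1))⁻¹ * (x + 1) * (x + m)) /
    ((x + ((m : ℝ) - 1) * ((m : ℝ) ^ i)⁻¹ + 1) *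
      (x + ((m : ℝ) - 1) * ((m : ℝ) ^ (i + 1))⁻¹ + 1))

theorem chanProb_nonneg {m : ℕ} (hm : 2 ≤ m) (i : ℕ) {x : ℝ} (hx : 0 ≤ x) :
    0 ≤ chanProb m i x := by
  have h1 : (0 : ℝ) ≤ (m : ℝ) - 1 := by
    have : (2 : ℝ) ≤ m := by exact_mod_cast hm
    linarith
  unfold chanProb
  positivity

theorem hasSum_chanProb {m : ℕ} (hm : 2 ≤ m) {x : ℝ} (hx : 0 ≤ x) :
    HasSum (fun i => chanProb m i x) 1 := by
  have h2 : (2 : ℝ) ≤ m := by exact_mod_cast hm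
  have h1 : (0 : ℝ) < (m : ℝ) - 1 := by linarith
  have hm0 : (m : ℝ) ≠ 0 := by linarith
  rw [hasSum_iff_tendsto_nat_of_nonneg (fun i => chanProb_nonneg hm i hx)]
  set g : ℕ → ℝ := fun i =>
    (x + 1) * (x + m) / ((m : ℝ) - 1) * (1 / (x + ((m : ℝ) - 1) * ((m : ℝ) ^ i)⁻¹ + 1)) with hg
  have hstep : ∀ i, chanProb m i x = g (i + 1) - g i := by
    intro i
    have ha : x + ((m : ℝ) - 1) * ((m : ℝ) ^ i)⁻¹ + 1 ≠ 0 := by positivity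
    have hb : x + ((m : ℝ) - 1) * ((m : ℝ) ^ (i + 1))⁻¹ + 1 ≠ 0 := by positivity
    have hpow : ((m : ℝ) ^ i)⁻¹ = m * ((m : ℝ) ^ (i + 1))⁻¹ := by
      rw [pow_succ]; field_simp
    simp only [hg, chanProb]
    rw [← mul_sub, div_sub_div _ _ hb ha, div_mul_div_comm, mul_comm (x + _ + 1),
      div_eq_div_iff (mul_ne_zero hb ha) (mul_ne_zero h1.ne' (mul_ne_zero hb ha))]
    rw [hpow]
    ring
  simp_rw [hstep, Finset.sum_range_sub]
  have hlim : Tendsto (fun i : ℕ => ((m : ℝ) ^ i)⁻¹) atTop (𝓝 0) :=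
    (tendsto_pow_atTop_atTop_of_one_lt (by linarith)).inv_tendsto_atTop
  have h3 : Tendsto g atTop
      (𝓝 ((x + 1) * (x + m) / ((m : ℝ) - 1) * (1 / (x + ((m : ℝ) - 1) * 0 + 1)))) :=
    (tendsto_const_nhds.div (((hlim.const_mul _).const_add x).add_const 1) (by
      rw [mul_zero, add_zero]; positivity)).const_mul _
  have h4 := h3.sub_const (g 0)
  convert h4 using 2
  simp only [hg, mul_zero, add_zero, pow_zero, inv_one, mul_one]
  have hx1 : x + 1 ≠ 0 := by positivity
  have hxm : x + m ≠ 0 := by positivity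
  rw [show x + ((m : ℝ) - 1) + 1 = x + m by ring]
  field_simp
  ring

/-- The transition probability function `x ↦ (P_i(c x))_{i ∈ ℕ}` from `[0, 1]` to `ℕ`, that is
`P(x, A) = ∑_{i ∈ A} P_i(c x)`. -/
noncomputable def chanKernel (m : ℕ) (c : ℝ≥0) : Kernel I ℕ where
  toFun x := Measure.sum fun i => ENNReal.ofReal (chanProb m i (c * x)) • Measure.dirac i
  measurable' := by
    refine Measure.measurable_of_measurable_coe _ fun A hA => ?_
    simp only [Measure.sum_apply _ hA, Measure.smul_apply, smul_eq_mul]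
    refine Measurable.tsum fun i => Measurable.mul_const ?_ _
    unfold chanProb
    fun_prop

theorem isMarkovKernel_chanKernel {m : ℕ} (hm : 2 ≤ m) (c : ℝ≥0) :
    IsMarkovKernel (chanKernel m c) := by
  refine ⟨fun x => ⟨?_⟩⟩
  have hx : (0 : ℝ) ≤ c * x := mul_nonneg c.2 x.2.1
  change (Measure.sum fun i => ENNReal.ofReal (chanProb m i (c * x)) • Measure.dirac i)
    Set.univ = 1
  simp only [Measure.sum_apply _ MeasurableSet.univ, Measure.smul_apply, smul_eq_mul,
    measure_univ, mul_one]
  rw [← ENNReal.ofReal_tsum_of_nonneg (fun i => chanProb_nonneg hm i hx)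
    (hasSum_chanProb hm hx).summable, (hasSum_chanProb hm hx).tsum_eq, ENNReal.ofReal_one]

/-- `u_i(x) = m^{-i} / (1 + (m-1) x)`, as a real number. -/
noncomputable def chanMap (m i : ℕ) (x : ℝ) : ℝ :=
  ((m : ℝ) ^ i)⁻¹ / (1 + ((m : ℝ) - 1) * x)

theorem chanMap_mem {m : ℕ} (hm : 2 ≤ m) (i : ℕ) (x : I) : chanMap m i x ∈ I := by
  have h2 : (2 : ℝ) ≤ m := by exact_mod_cast hm
  have h1 : (0 : ℝ) ≤ ((m : ℝ) - 1) * x := mul_nonneg (by linarith) x.2.1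
  refine ⟨by unfold chanMap; positivity, ?_⟩
  unfold chanMap
  rw [div_le_one (by positivity)]
  have : ((m : ℝ) ^ i)⁻¹ ≤ 1 := inv_le_one_of_one_le₀ (one_le_pow₀ (by linarith))
  linarith

/-- The RSCC `(([0,1], Borel), (ℕ, all subsets), u, P)` with `u(x, i) = u_i(x)` and
`P(x, i) = P_i(c x)`. -/
noncomputable def chanRSCC (m : ℕ) (hm : 2 ≤ m) (c : ℝ≥0) : RSCC I ℕ where
  u p := ⟨chanMap m p.2 p.1, chanMap_mem hm p.2 p.1⟩
  measurable_u := by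
    refine Measurable.subtype_mk ?_
    refine measurable_from_prod_countable_left fun i => ?_
    unfold chanMap
    fun_prop
  P := chanKernel m c
  isMarkov := isMarkovKernel_chanKernel hm c

end Chan

/-! In the logarithmic gauge `chanGauge`, ρ(x, y) = |log(1+(m-1)x) - log(1+(m-1)y)|, every single
map u_i is a contraction with ratio λ = (m-1)/m (`chanGauge_u_le`), and the transition probabilities
satisfy P(y, ·) ≥ exp(-bρ(x, y)) P(x, ·) (`smul_chanKernel_le`). The gauge is bounded and
bi-Lipschitz to the usual distance, so words of length k contract the latter by a multiple of λ^k.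
This gives contraction of the RSCC.

For the operator, measure f by the least N with |f x - f y| ≤ N(1 - exp(-aρ(x, y))). Comparing P(x,
·) with P(y, ·) replaces the exponent a by b + aλ (`U_sub_le`). For a large this is at most a - 1,
and since ρ ≤ D the gain can be traded for a factor q < 1 on N with a unchanged (`one_sub_exp_le`).
Hence the Lipschitz constants of U^n f decay geometrically, with no spectral theory
(`exists_geometric_bound`). Compactness supplies a limit law (`exists_limit_measure`), and geometric
convergence in the Lipschitz norm and regularity follow. -/

theorem integrable_of_abs_le {α : Type*} [MeasurableSpace α] (μ : Measure α) [IsFiniteMeasure μ]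
    {f : α → ℝ} (hf : Measurable f) {B : ℝ} (hB : ∀ x, |f x| ≤ B) : Integrable f μ :=
  .of_bound hf.aestronglyMeasurable B (.of_forall fun x => by simpa using hB x)

theorem abs_integral_le_of_abs_le {α : Type*} [MeasurableSpace α] (μ : Measure α)
    [IsProbabilityMeasure μ] {f : α → ℝ} {B : ℝ} (hB : ∀ x, |f x| ≤ B) : |∫ x, f x ∂μ| ≤ B := by
  simpa using norm_integral_le_of_norm_le_const (μ := μ) (f := f) (C := B)
    (.of_forall fun x => by simpa using hB x)

theorem abs_sub_integral_le {α : Type*} [MeasurableSpace α] (μ : Measure α)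
    [IsProbabilityMeasure μ] {f : α → ℝ} (hf : Integrable f μ) {a B : ℝ}
    (hB : ∀ x, |a - f x| ≤ B) : |a - ∫ x, f x ∂μ| ≤ B := by
  have h := abs_integral_le_of_abs_le μ hB
  rwa [integral_sub (integrable_const a) hf, integral_const, probReal_univ, one_smul] at h

theorem exists_bounds_of_osc_le {W : Type*} [Nonempty W] {f : W → ℝ} {N : ℝ}
    (h : ∀ x y, |f x - f y| ≤ N) : ∃ M, ∀ x, f x ≤ M ∧ M - N ≤ f x := by
  have hb : BddAbove (Set.range f) := by
    obtain ⟨w⟩ := ‹Nonempty W›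
    refine ⟨f w + N, ?_⟩
    rintro _ ⟨x, rfl⟩
    linarith [(abs_le.1 (h x w)).2]
  refine ⟨⨆ x, f x, fun x => ⟨le_ciSup hb x, ?_⟩⟩
  rw [sub_le_iff_le_add]
  exact ciSup_le fun y => by linarith [(abs_le.1 (h y x)).2]

theorem continuous_of_abs_sub_le {W : Type*} [MetricSpace W] {f : W → ℝ} {L : ℝ}
    (hf : ∀ x y, |f x - f y| ≤ L * dist x y) : Continuous f :=
  (LipschitzWith.of_dist_le_mul (K := L.toNNReal) fun x y => by
    rw [Real.dist_eq]
    exact (hf x y).trans (by gcongr; exact Real.le_coe_toNNReal L)).continuous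

/-- Lowering the exponent by 1 gains a factor e^t ≥ 1 + t, hence at least t e^{-at} ≥ t e^{-aD}; as
1 - e^{-at} ≤ at, this is a fixed proportion of 1 - e^{-at}. -/
theorem one_sub_exp_le {a a' t D : ℝ} (ha : 0 < a) (haa : a' ≤ a - 1) (ht : 0 ≤ t) (htD : t ≤ D) :
    1 - Real.exp (-(a' * t)) ≤ (1 - Real.exp (-(a * D)) / a) * (1 - Real.exp (-(a * t))) := by
  have h1 : Real.exp (-(a * t)) * (1 + t) ≤ Real.exp (-(a' * t)) := by
    calc Real.exp (-(a * t)) * (1 + t) ≤ Real.exp (-(a * t)) * Real.exp t := by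
          gcongr; linarith [Real.add_one_le_exp t]
      _ = Real.exp (-(a * t) + t) := (Real.exp_add _ _).symm
      _ ≤ _ := Real.exp_le_exp.2 (by nlinarith)
  have h2 : 1 - Real.exp (-(a * t)) ≤ a * t := by linarith [Real.add_one_le_exp (-(a * t))]
  have h3 : Real.exp (-(a * D)) ≤ Real.exp (-(a * t)) := Real.exp_le_exp.2 (by nlinarith)
  have h4 : Real.exp (-(a * D)) / a * (1 - Real.exp (-(a * t))) ≤ Real.exp (-(a * t)) * t := by
    calc _ ≤ Real.exp (-(a * D)) / a * (a * t) := by gcongr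
      _ = Real.exp (-(a * D)) * t := by field_simp
      _ ≤ _ := by gcongr
  linarith

namespace RSCC

/-! ### Iterates of the Markov operator as kernel integrals -/

section Iterates

variable {W X : Type*} [MeasurableSpace W] [MeasurableSpace X]

theorem isMarkovKernel_wordKernel (R : RSCC W X) (k : ℕ) : IsMarkovKernel (R.wordKernel k) := by
  have := R.isMarkov
  induction k with
  | zero => rw [wordKernel]; infer_instance
  | succ k ih => rw [wordKernel]; exact Kernel.IsMarkovKernel.map _ (measurable_cons k)

theorem Q_apply (R : RSCC W X) (w : W) : R.Q w = (R.P w).map fun x => R.u (w, x) := by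
  have := R.isMarkov
  rw [Q, Kernel.map_apply _ R.measurable_u, Kernel.prod_apply, Kernel.id_apply, Measure.dirac_prod,
    Measure.map_map R.measurable_u measurable_prodMk_left]
  rfl

theorem isMarkovKernel_Q (R : RSCC W X) : IsMarkovKernel R.Q := by
  have := R.isMarkov
  rw [Q]
  exact Kernel.IsMarkovKernel.map _ R.measurable_u

theorem U_apply (R : RSCC W X) {f : W → ℝ} (hf : Measurable f) (w : W) :
    R.U f w = ∫ x, f (R.u (w, x)) ∂(R.P w) := by
  have hu : Measurable fun x => R.u (w, x) := R.measurable_u.comp measurable_prodMk_left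
  rw [U, Q_apply, integral_map hu.aemeasurable hf.aestronglyMeasurable]

theorem measurable_U (R : RSCC W X) {f : W → ℝ} (hf : Measurable f) : Measurable (R.U f) :=
  have := R.isMarkovKernel_Q
  hf.stronglyMeasurable.integral_kernel.measurable

/-- The `n`-step transition probability function of the associated Markov chain. -/
noncomputable def stepKernel (R : RSCC W X) : ℕ → Kernel W W
  | 0 => Kernel.id
  | n + 1 => R.stepKernel n ∘ₖ R.Q

theorem isMarkovKernel_stepKernel (R : RSCC W X) (n : ℕ) : IsMarkovKernel (R.stepKernel n) := by
  have := R.isMarkovKernel_Q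
  induction n with
  | zero => rw [stepKernel]; infer_instance
  | succ n ih => rw [stepKernel]; infer_instance

theorem iterate_U_apply (R : RSCC W X) {f : W → ℝ} (hf : Measurable f) {B : ℝ}
    (hB : ∀ w, |f w| ≤ B) (n : ℕ) (w : W) : R.U^[n] f w = ∫ y, f y ∂(R.stepKernel n w) := by
  induction n generalizing w with
  | zero => simp [stepKernel, Kernel.id_apply, integral_dirac' _ _ hf.stronglyMeasurable]
  | succ n ih =>
    have := R.isMarkovKernel_stepKernel (n + 1)
    rw [Function.iterate_succ_apply', stepKernel, Kernel.integral_comp, U]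
    · exact integral_congr_ae (.of_forall fun y => ih y)
    · exact integrable_of_abs_le (R.stepKernel (n + 1) w) hf hB

end Iterates

/-- A gauge `ρ` on the state space contracted by all maps `u (·, x)`, in which the transition
probabilities are log-Lipschitz. -/
structure IsContractingGauge {W X : Type*} [MeasurableSpace W] [MeasurableSpace X]
    (R : RSCC W X) (ρ : W → W → ℝ) (lam b D : ℝ) : Prop where
  symm : ∀ x y, ρ x y = ρ y x
  nonneg : ∀ x y, 0 ≤ ρ x y
  le_bound : ∀ x y, ρ x y ≤ D
  u_le : ∀ x y i, ρ (R.u (x, i)) (R.u (y, i)) ≤ lam * ρ x y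
  smul_le : ∀ x y, ENNReal.ofReal (Real.exp (-(b * ρ x y))) • R.P x ≤ R.P y
  lam_nonneg : 0 ≤ lam
  lam_lt_one : lam < 1
  b_nonneg : 0 ≤ b

/-! ### Decay of an exponential modulus of continuity -/

section Gauge

variable {W X : Type*} [MeasurableSpace W] [MeasurableSpace X] {R : RSCC W X} {ρ : W → W → ℝ}
  {lam b D : ℝ}

namespace IsContractingGauge

/-- One application of the Markov operator improves the exponent in an exponential modulus of
continuity. -/
theorem U_sub_le (h : IsContractingGauge R ρ lam b D) {f : W → ℝ} (hf : Measurable f)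
    {N a : ℝ} (hN : 0 ≤ N) (ha : 0 ≤ a)
    (hfN : ∀ x y, |f x - f y| ≤ N * (1 - Real.exp (-(a * ρ x y)))) (x y : W) :
    R.U f x - R.U f y ≤ N * (1 - Real.exp (-((b + a * lam) * ρ x y))) := by
  have := R.isMarkov
  have : Nonempty W := ⟨x⟩
  have hosc : ∀ x y, |f x - f y| ≤ N := fun x y => (hfN x y).trans <|
    mul_le_of_le_one_right hN (by linarith [Real.exp_pos (-(a * ρ x y))])
  obtain ⟨M, hM⟩ := exists_bounds_of_osc_le hosc
  have hfB : ∀ w, |f w| ≤ |M| + N := fun w => by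
    rw [abs_le]
    constructor <;> linarith [hM w, neg_abs_le M, le_abs_self M]
  have hmeas : ∀ w, Measurable fun i => f (R.u (w, i)) := fun w =>
    hf.comp (R.measurable_u.comp measurable_prodMk_left)
  have hint : ∀ w v, Integrable (fun i => f (R.u (w, i))) (R.P v) := fun w v =>
    integrable_of_abs_le _ (hmeas w) fun i => hfB _
  set s := Real.exp (-(b * ρ y x)) with hs
  have hs1 : s ≤ 1 := Real.exp_le_one_iff.2
    (neg_nonpos.2 (mul_nonneg h.b_nonneg (h.nonneg _ _)))
  have hs0 : 0 ≤ s := (Real.exp_pos _).le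
  set A := ∫ i, f (R.u (x, i)) ∂(R.P y)
  -- Since M - f ≥ 0 and s P(y, ·) ≤ P(x, ·), the value U f x is at most sA + (1 - s)M. The weight s
  -- then pays the contracted oscillation N(1 - t), the weight 1 - s the full oscillation N, for a
  -- total of N(1 - st).
  have h1 : s * (M - A) ≤ M - R.U f x := by
    have h2 := integral_mono_measure (f := fun i => M - f (R.u (x, i))) (h.smul_le y x)
      (.of_forall fun i => sub_nonneg.2 (hM _).1) ((integrable_const M).sub (hint x x))
    rwa [integral_smul_measure, integral_sub (integrable_const M) (hint x y),
      integral_sub (integrable_const M) (hint x x), ENNReal.toReal_ofReal (Real.exp_pos _).le,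
      integral_const, integral_const, probReal_univ, probReal_univ, one_smul, smul_eq_mul,
      ← U_apply R hf] at h2
  have h2 : M - N ≤ R.U f y := by
    rw [U_apply R hf]
    have := integral_mono (μ := R.P y) (integrable_const (M - N)) (hint y y)
      fun i => (hM (R.u (y, i))).2
    rwa [integral_const, probReal_univ, one_smul] at this
  set t := Real.exp (-(a * lam * ρ x y)) with ht
  have h3 : A - R.U f y ≤ N * (1 - t) := by
    rw [U_apply R hf, ← integral_sub (hint x y) (hint y y)]
    have := integral_mono (μ := R.P y) ((hint x y).sub (hint y y))
      (integrable_const (N * (1 - t))) fun i => by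
        refine (le_abs_self _).trans ((hfN _ _).trans ?_)
        have := mul_le_mul_of_nonneg_left (h.u_le x y i) ha
        gcongr N * (1 - ?_)
        exact Real.exp_le_exp.2 (by linarith)
    rwa [integral_const, probReal_univ, one_smul] at this
  have hst : Real.exp (-((b + a * lam) * ρ x y)) = s * t := by
    rw [hs, ht, ← Real.exp_add, h.symm y x]
    ring_nf
  rw [hst]
  nlinarith [mul_le_mul_of_nonneg_left h3 hs0,
    mul_le_mul_of_nonneg_left (show M - R.U f y ≤ N by linarith) (sub_nonneg.2 hs1)]

theorem abs_U_sub_le (h : IsContractingGauge R ρ lam b D) {f : W → ℝ} (hf : Measurable f)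
    {N a : ℝ} (hN : 0 ≤ N) (ha : 0 < a) (hab : b + a * lam ≤ a - 1)
    (hfN : ∀ x y, |f x - f y| ≤ N * (1 - Real.exp (-(a * ρ x y)))) (x y : W) :
    |R.U f x - R.U f y| ≤
      N * (1 - Real.exp (-(a * D)) / a) * (1 - Real.exp (-(a * ρ x y))) := by
  have key : ∀ x y, R.U f x - R.U f y ≤
      N * (1 - Real.exp (-(a * D)) / a) * (1 - Real.exp (-(a * ρ x y))) := fun x y => by
    rw [mul_assoc]
    exact (h.U_sub_le hf hN ha.le hfN x y).trans
      (mul_le_mul_of_nonneg_left (one_sub_exp_le ha hab (h.nonneg _ _) (h.le_bound _ _)) hN)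
  refine abs_sub_le_iff.2 ⟨key x y, ?_⟩
  rw [h.symm x y]
  exact key y x

theorem abs_iterate_U_sub_le (h : IsContractingGauge R ρ lam b D) {f : W → ℝ} (hf : Measurable f)
    {N a : ℝ} (hN : 0 ≤ N) (ha : 0 < a) (hab : b + a * lam ≤ a - 1)
    (hq : 0 ≤ 1 - Real.exp (-(a * D)) / a)
    (hfN : ∀ x y, |f x - f y| ≤ N * (1 - Real.exp (-(a * ρ x y)))) (n : ℕ) :
    Measurable (R.U^[n] f) ∧ ∀ x y, |R.U^[n] f x - R.U^[n] f y| ≤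
      N * (1 - Real.exp (-(a * D)) / a) ^ n * (1 - Real.exp (-(a * ρ x y))) := by
  induction n with
  | zero => simpa using ⟨hf, hfN⟩
  | succ n ih =>
    rw [Function.iterate_succ_apply']
    refine ⟨R.measurable_U ih.1, fun x y => ?_⟩
    rw [pow_succ, ← mul_assoc]
    exact h.abs_U_sub_le ih.1 (by positivity) ha hab ih.2 x y

end IsContractingGauge

end Gauge

/-! ### From the gauge to the metric, and the limit law -/

section Metric

variable {W X : Type*} [MetricSpace W] [MeasurableSpace W] [BorelSpace W] [MeasurableSpace X]
  {R : RSCC W X} {ρ : W → W → ℝ} {lam b D : ℝ}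

theorem IsContractingGauge.exists_geometric_bound (h : IsContractingGauge R ρ lam b D)
    {c₁ c₂ : ℝ} (hc₁ : 0 < c₁) (hc₂ : 0 < c₂) (h₁ : ∀ x y, c₁ * dist x y ≤ ρ x y)
    (h₂ : ∀ x y, ρ x y ≤ c₂ * dist x y) :
    ∃ C q : ℝ, 0 < C ∧ 0 < q ∧ q < 1 ∧ ∀ (f : W → ℝ) (L : ℝ), 0 ≤ L →
      (∀ x y, |f x - f y| ≤ L * dist x y) → ∀ n x y,
        |R.U^[n] f x - R.U^[n] f y| ≤ C * q ^ n * L * dist x y := by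
  have hl := h.lam_lt_one
  have hl0 := h.lam_nonneg
  have hb := h.b_nonneg
  obtain hW | ⟨⟨w⟩⟩ := isEmpty_or_nonempty W
  · exact ⟨1, 1 / 2, by norm_num, by norm_num, by norm_num, fun f L _ _ n x => hW.elim x⟩
  have hD : 0 ≤ D := (h.nonneg w w).trans (h.le_bound w w)
  -- This makes b + aλ = a - 2. The numerator b + 2 also forces a ≥ 2, so that the rate 1 -
  -- e^{-aD}/a is strictly positive.
  set a := (b + 2) / (1 - lam) with ha_def
  have ha2 : 2 ≤ a := by rw [ha_def, le_div_iff₀ (by linarith)]; linarith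
  have ha : 0 < a := by linarith
  have hab : b + a * lam ≤ a - 1 := by
    have : a * (1 - lam) = b + 2 := by rw [ha_def]; field_simp [show (1 - lam) ≠ 0 by linarith]
    linarith
  have he : Real.exp (-(a * D)) ≤ 1 := Real.exp_le_one_iff.2 (by nlinarith)
  have hq0 : 0 < 1 - Real.exp (-(a * D)) / a := by
    rw [sub_pos, div_lt_one ha]; linarith
  refine ⟨Real.exp (a * D) / c₁ * c₂, 1 - Real.exp (-(a * D)) / a, by positivity, hq0, ?_, ?_⟩
  · have : 0 < Real.exp (-(a * D)) / a := by positivity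
    linarith
  intro f L hL hf n x y
  have hN : ∀ x y, |f x - f y| ≤
      Real.exp (a * D) / (a * c₁) * L * (1 - Real.exp (-(a * ρ x y))) := fun x y => by
    have hρ := h.nonneg x y
    -- On the bounded range of ρ, 1 - e^{-s} ≥ s e^{-s} ≥ s e^{-aD} with s = aρ; this converts a
    -- Lipschitz bound into the exponential modulus.
    have e1 : Real.exp (-(a * D)) * (a * ρ x y) ≤ 1 - Real.exp (-(a * ρ x y)) := by
      have e2 : Real.exp (-(a * D)) ≤ Real.exp (-(a * ρ x y)) :=
        Real.exp_le_exp.2 (by nlinarith [h.le_bound x y])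
      have e3 : Real.exp (-(a * ρ x y)) * (a * ρ x y + 1) ≤ 1 := by
        calc _ ≤ Real.exp (-(a * ρ x y)) * Real.exp (a * ρ x y) := by
              gcongr; exact Real.add_one_le_exp _
          _ = 1 := by rw [← Real.exp_add]; simp
      nlinarith [mul_le_mul_of_nonneg_right e2 (mul_nonneg ha.le hρ)]
    calc |f x - f y| ≤ L * dist x y := hf x y
      _ ≤ L * (ρ x y / c₁) := by
          gcongr; rw [le_div_iff₀ hc₁, mul_comm]; exact h₁ x y
      _ = Real.exp (a * D) / (a * c₁) * L * (Real.exp (-(a * D)) * (a * ρ x y)) := by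
          rw [Real.exp_neg]; field_simp
      _ ≤ _ := by gcongr
  refine ((h.abs_iterate_U_sub_le (continuous_of_abs_sub_le hf).measurable (by positivity) ha hab
    hq0.le hN n).2 x y).trans ?_
  have e4 : 1 - Real.exp (-(a * ρ x y)) ≤ a * (c₂ * dist x y) := by
    have := mul_le_mul_of_nonneg_left (h₂ x y) ha.le
    linarith [Real.add_one_le_exp (-(a * ρ x y))]
  calc _ ≤ Real.exp (a * D) / (a * c₁) * L * (1 - Real.exp (-(a * D)) / a) ^ n *
        (a * (c₂ * dist x y)) := by gcongr
    _ = _ := by field_simp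

/-- On a compact state space, a uniform geometric bound on the Lipschitz constants of the iterates
of the Markov operator yields a limiting probability measure. -/
theorem exists_limit_measure [CompactSpace W] [Nonempty W] {C q Δ : ℝ} (hC : 0 < C) (hq : 0 < q)
    (hΔ : ∀ x y : W, dist x y ≤ Δ)
    (H : ∀ (f : W → ℝ) (L : ℝ), 0 ≤ L → (∀ x y, |f x - f y| ≤ L * dist x y) → ∀ n x y,
        |R.U^[n] f x - R.U^[n] f y| ≤ C * q ^ n * L * dist x y) :
    ∃ μ : Measure W, IsProbabilityMeasure μ ∧ ∀ (f : W → ℝ) (L : ℝ), 0 ≤ L →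
      (∀ x y, |f x - f y| ≤ L * dist x y) → ∀ n x,
        |R.U^[n] f x - ∫ y, f y ∂μ| ≤ C * q ^ n * L * Δ := by
  obtain ⟨w⟩ := ‹Nonempty W›
  have hM := R.isMarkovKernel_stepKernel
  let ν : ℕ → ProbabilityMeasure W := fun n => ⟨R.stepKernel n w, inferInstance⟩
  -- The laws of the chain started at w have a limit along any ultrafilter, by weak compactness of
  -- the probability measures; a nonprincipal one reaches arbitrarily late times.
  obtain ⟨μ, -, hμ⟩ := isCompact_univ.ultrafilter_le_nhds
    ((hyperfilter ℕ).map ν) (by simp)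
  refine ⟨μ, inferInstance, fun f L hL hf n x => ?_⟩
  have hcont : ∀ n, Continuous (R.U^[n] f) := fun n => continuous_of_abs_sub_le (H f L hL hf n)
  have hbd : ∀ n, ∃ B, ∀ x, |R.U^[n] f x| ≤ B := fun n => by
    obtain ⟨B, hB⟩ := isCompact_univ.exists_bound_of_continuousOn (hcont n).continuousOn
    exact ⟨B, fun x => hB x trivial⟩
  have hlim : Tendsto (fun k => R.U^[k] f w) (hyperfilter ℕ) (𝓝 (∫ y, f y ∂(μ : Measure W))) := by
    have := ProbabilityMeasure.tendsto_iff_forall_integral_tendsto.1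
      (show Tendsto ν (hyperfilter ℕ) (𝓝 μ) from hμ)
      (BoundedContinuousFunction.mkOfCompact ⟨f, hcont 0⟩)
    obtain ⟨B, hB⟩ := hbd 0
    refine this.congr fun k => ?_
    exact (R.iterate_U_apply (hcont 0).measurable hB k w).symm
  refine le_of_tendsto (hlim.const_sub (R.U^[n] f x)).abs ?_
  have hev : ∀ᶠ k in (hyperfilter ℕ : Filter ℕ), n ≤ k :=
    Nat.hyperfilter_le_atTop (eventually_ge_atTop n)
  filter_upwards [hev] with k hk
  obtain ⟨j, rfl⟩ := Nat.exists_eq_add_of_le' hk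
  obtain ⟨B, hB⟩ := hbd n
  -- U^{j+n} f(w) is an average of values of U^n f, so it differs from U^n f(x) by at most the
  -- oscillation of U^n f, uniformly in j.
  rw [Function.iterate_add_apply, R.iterate_U_apply (hcont n).measurable hB j w]
  refine abs_sub_integral_le _ (integrable_of_abs_le _ (hcont n).measurable hB) fun y => ?_
  exact (H f L hL hf n x y).trans (mul_le_mul_of_nonneg_left (hΔ x y) (by positivity))

end Metric

end RSCC

/-! ### Real-valued bounds behind the Lipschitz norm -/

section LipNorm

variable {W : Type*} [MetricSpace W]

theorem lipNorm_le_of_bounds {g : W → ℝ} {S L : ℝ} (hS : ∀ x, |g x| ≤ S)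
    (hL : ∀ x y, |g x - g y| ≤ L * dist x y) :
    lipNorm g ≤ ENNReal.ofReal S + ENNReal.ofReal L := by
  unfold lipNorm
  gcongr
  · refine iSup_le fun x => ?_
    rw [Real.enorm_eq_ofReal_abs]
    exact ENNReal.ofReal_le_ofReal (hS x)
  · refine iSup_le fun x => iSup_le fun y => iSup_le fun h => ?_
    refine ENNReal.div_le_of_le_mul ?_
    rw [edist_dist, edist_dist, ← ENNReal.ofReal_mul' dist_nonneg, Real.dist_eq]
    exact ENNReal.ofReal_le_ofReal (hL x y)

theorem exists_bounds_of_mem_lipSpace {f : W → ℝ} (hf : f ∈ lipSpace W) :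
    ∃ S L : ℝ, 0 ≤ S ∧ 0 ≤ L ∧ lipNorm f = ENNReal.ofReal S + ENNReal.ofReal L ∧
      (∀ x, |f x| ≤ S) ∧ ∀ x y, |f x - f y| ≤ L * dist x y := by
  obtain ⟨h1, h2⟩ := ENNReal.add_lt_top.1 (show lipNorm f < ∞ from hf)
  refine ⟨(⨆ x, ‖f x‖ₑ).toReal,
    (⨆ (x : W) (y : W) (_ : x ≠ y), edist (f x) (f y) / edist x y).toReal,
    ENNReal.toReal_nonneg, ENNReal.toReal_nonneg, ?_, fun x => ?_, fun x y => ?_⟩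
  rotate_left
  · rw [← ENNReal.ofReal_le_iff_le_toReal h1.ne, ← Real.enorm_eq_ofReal_abs]
    exact le_iSup (fun x => ‖f x‖ₑ) x
  · obtain rfl | hxy := eq_or_ne x y
    · simp
    · rw [← div_le_iff₀ (dist_pos.2 hxy), ← ENNReal.ofReal_le_iff_le_toReal h2.ne,
        ENNReal.ofReal_div_of_pos (dist_pos.2 hxy), ← Real.dist_eq, ← edist_dist, ← edist_dist]
      exact edist_div_le_iSup f hxy
  · rw [ENNReal.ofReal_toReal h1.ne, ENNReal.ofReal_toReal h2.ne, lipNorm]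

theorem lipNorm_const_le (a : ℝ) : lipNorm (fun _ : W => a) ≤ ‖a‖ₑ := by
  rw [Real.enorm_eq_ofReal_abs]
  simpa using lipNorm_le_of_bounds (W := W) (g := fun _ => a) (S := |a|) (L := 0)
    (fun _ => le_rfl) (by simp)

theorem enorm_integral_le_lipNorm [MeasurableSpace W] (μ : Measure W) [IsProbabilityMeasure μ]
    {f : W → ℝ} (hf : f ∈ lipSpace W) : ‖∫ y, f y ∂μ‖ₑ ≤ lipNorm f := by
  obtain ⟨S, L, -, -, hSL, hS, -⟩ := exists_bounds_of_mem_lipSpace hf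
  rw [hSL, Real.enorm_eq_ofReal_abs]
  exact (ENNReal.ofReal_le_ofReal (abs_integral_le_of_abs_le μ hS)).trans le_self_add

theorem integrable_of_mem_lipSpace [MeasurableSpace W] [BorelSpace W] (μ : Measure W)
    [IsFiniteMeasure μ] {f : W → ℝ} (hf : f ∈ lipSpace W) : Integrable f μ := by
  obtain ⟨S, L, -, -, -, hS, hL⟩ := exists_bounds_of_mem_lipSpace hf
  exact integrable_of_abs_le μ (continuous_of_abs_sub_le hL).measurable hS

end LipNorm

namespace RSCC

/-! ### Norm convergence and regularity -/

section Regular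

variable {W X : Type*} [MetricSpace W] [MeasurableSpace W] [BorelSpace W] [MeasurableSpace X]
  {R : RSCC W X}

theorem exists_lipNorm_iterate_sub_le [CompactSpace W] [Nonempty W] {C q Δ : ℝ} (hC : 0 < C)
    (hq : 0 < q) (hΔ : ∀ x y : W, dist x y ≤ Δ)
    (H : ∀ (f : W → ℝ) (L : ℝ), 0 ≤ L → (∀ x y, |f x - f y| ≤ L * dist x y) → ∀ n x y,
        |R.U^[n] f x - R.U^[n] f y| ≤ C * q ^ n * L * dist x y) :
    ∃ μ : Measure W, IsProbabilityMeasure μ ∧ ∃ k : ℝ, 0 < k ∧ ∀ n, ∀ f ∈ lipSpace W,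
      lipNorm (fun x => R.U^[n] f x - ∫ y, f y ∂μ) ≤ ENNReal.ofReal (k * q ^ n) * lipNorm f := by
  obtain ⟨μ, hμ, hlim⟩ := exists_limit_measure hC hq hΔ H
  obtain ⟨w⟩ := ‹Nonempty W›
  have hΔ0 : 0 ≤ Δ := dist_nonneg.trans (hΔ w w)
  refine ⟨μ, hμ, C * (Δ + 1), by positivity, fun n f hf => ?_⟩
  obtain ⟨S, L, hS0, hL0, hSL, hS, hL⟩ := exists_bounds_of_mem_lipSpace hf
  have hosc : ∀ x y, |(R.U^[n] f x - ∫ y, f y ∂μ) - (R.U^[n] f y - ∫ y, f y ∂μ)| ≤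
      C * q ^ n * L * dist x y := fun x y => by
    rw [sub_sub_sub_cancel_right]
    exact H f L hL0 hL n x y
  calc _ ≤ ENNReal.ofReal (C * q ^ n * L * Δ) + ENNReal.ofReal (C * q ^ n * L) :=
        lipNorm_le_of_bounds (hlim f L hL0 hL n) hosc
    _ = ENNReal.ofReal (C * (Δ + 1) * q ^ n) * ENNReal.ofReal L := by
        rw [← ENNReal.ofReal_add (by positivity) (by positivity),
          ← ENNReal.ofReal_mul (by positivity)]
        ring_nf
    _ ≤ _ := by
        rw [hSL]
        gcongr
        exact le_add_self

theorem isRegularLip_of_lipNorm_iterate_sub_le [Nonempty W] (μ : Measure W)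
    [IsProbabilityMeasure μ] {k q : ℝ} (hq0 : 0 ≤ q) (hq1 : q < 1)
    (H : ∀ n, ∀ f ∈ lipSpace W,
      lipNorm (fun x => R.U^[n] f x - ∫ y, f y ∂μ) ≤ ENNReal.ofReal (k * q ^ n) * lipNorm f) :
    IsRegularLip R.U := by
  have hQ := R.isMarkovKernel_Q
  have hconst : ∀ a : ℝ, (fun _ : W => a) ∈ lipSpace W := fun a =>
    (lipNorm_const_le a).trans_lt enorm_lt_top
  have hU : ∀ f ∈ lipSpace W, lipNorm (R.U f) ≤ (ENNReal.ofReal (k * q ^ 1) + 1) * lipNorm f := by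
    intro f hf
    -- Boundedness of U comes from the case n = 1 of the convergence estimate plus the bounded
    -- functional f ↦ ∫ f dμ.
    have h1 : R.U f = (fun x => R.U^[1] f x - ∫ y, f y ∂μ) + fun _ => ∫ y, f y ∂μ := by
      ext x; simp
    rw [h1, add_mul, one_mul]
    exact (lipNorm_add_le _ _).trans (add_le_add (H 1 f hf)
      ((lipNorm_const_le _).trans (enorm_integral_le_lipNorm μ hf)))
  have hmem : ∀ f ∈ lipSpace W, R.U f ∈ lipSpace W := fun f hf =>
    (hU f hf).trans_lt (ENNReal.mul_lt_top (by finiteness) hf)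
  let T : Module.End ℝ (lipSpace W) :=
    { toFun := fun f => ⟨R.U f, hmem f f.2⟩
      map_add' := fun f g => Subtype.ext <| funext fun w =>
        integral_add (integrable_of_mem_lipSpace _ f.2) (integrable_of_mem_lipSpace _ g.2)
      map_smul' := fun a f => Subtype.ext <| funext fun w => integral_const_mul a _ }
  let V : Module.End ℝ (lipSpace W) :=
    { toFun := fun f => ⟨fun _ => ∫ y, (f : W → ℝ) y ∂μ, hconst _⟩
      map_add' := fun f g => Subtype.ext <| funext fun w =>
        integral_add (integrable_of_mem_lipSpace _ f.2) (integrable_of_mem_lipSpace _ g.2)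
      map_smul' := fun a f => Subtype.ext <| funext fun w => integral_const_mul a _ }
  have hT : ∀ n (f : lipSpace W), ((T ^ n) f : W → ℝ) = R.U^[n] f := by
    intro n
    induction n with
    | zero => simp
    | succ n ih =>
      intro f
      rw [pow_succ', Module.End.mul_apply, Function.iterate_succ_apply', ← ih f]
      rfl
  refine ⟨T, fun f => rfl, ?_, V, ?_, ?_, ?_⟩
  · refine lt_of_le_of_lt (b := (ENNReal.ofReal (k * q ^ 1) + 1) * 1)
      (iSup₂_le fun f hf => (hU f f.2).trans ?_) (by finiteness)
    gcongr
  · refine lt_of_le_of_lt (b := 1) (iSup₂_le fun f hf => ?_) (by finiteness)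
    exact (lipNorm_const_le _).trans ((enorm_integral_le_lipNorm μ f.2).trans hf)
  · have hlim : Tendsto (fun n : ℕ => ENNReal.ofReal (k * q ^ n)) atTop (𝓝 0) := by
      simpa using ENNReal.tendsto_ofReal
        ((tendsto_pow_atTop_nhds_zero_of_lt_one hq0 hq1).const_mul k)
    refine tendsto_of_tendsto_of_tendsto_of_le_of_le tendsto_const_nhds hlim
      (fun _ => zero_le) fun n => iSup₂_le fun f hf => ?_
    have h1 : ((T ^ n - V) f : W → ℝ) = fun x => R.U^[n] f x - ∫ y, (f : W → ℝ) y ∂μ := by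
      ext x
      rw [← hT]
      rfl
    rw [h1]
    exact (H n f f.2).trans (mul_le_of_le_one_right' hf)
  · let e : lipSpace W := ⟨fun _ => 1, hconst 1⟩
    have he : e ≠ 0 := fun h => by
      obtain ⟨w⟩ := ‹Nonempty W›
      exact one_ne_zero (congr_fun (congrArg Subtype.val h) w)
    have hr : LinearMap.range V = Submodule.span ℝ {e} := by
      ext g
      rw [LinearMap.mem_range, Submodule.mem_span_singleton]
      constructor
      · rintro ⟨f, rfl⟩
        exact ⟨∫ y, (f : W → ℝ) y ∂μ, Subtype.ext <| funext fun w => mul_one _⟩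
      · rintro ⟨a, rfl⟩
        refine ⟨a • e, Subtype.ext <| funext fun w => ?_⟩
        simp [V, e]
    rw [hr, finrank_span_singleton he]

end Regular

/-! ### Contraction of the RSCC -/

theorem IsContractingGauge.act_le {W X : Type*} [MeasurableSpace W] [MeasurableSpace X]
    {R : RSCC W X} {ρ : W → W → ℝ} {lam b D : ℝ} (h : IsContractingGauge R ρ lam b D)
    (k : ℕ) (x y : W) (i : Fin k → X) :
    ρ (R.act k x i) (R.act k y i) ≤ lam ^ k * ρ x y := by
  induction k generalizing x y with
  | zero => simp [act]
  | succ k ih =>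
    calc _ ≤ lam ^ k * ρ (R.u (x, i 0)) (R.u (y, i 0)) := ih _ _ _
      _ ≤ lam ^ k * (lam * ρ x y) :=
        mul_le_mul_of_nonneg_left (h.u_le _ _ _) (pow_nonneg h.lam_nonneg _)
      _ = _ := by ring

section Contraction

variable {W X : Type*} [MetricSpace W] [MeasurableSpace W] [MeasurableSpace X]
  {R : RSCC W X} {ρ : W → W → ℝ} {lam b D c₁ c₂ : ℝ}

namespace IsContractingGauge

/-- The contraction holds word by word, so averaging costs nothing; passing to ρ and back costs the
factor c₂/c₁. -/
theorem r_le (h : IsContractingGauge R ρ lam b D) (hc₁ : 0 < c₁)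
    (h₁ : ∀ x y, c₁ * dist x y ≤ ρ x y) (h₂ : ∀ x y, ρ x y ≤ c₂ * dist x y) (k : ℕ) :
    R.r k ≤ ENNReal.ofReal (c₂ / c₁ * lam ^ k) := by
  have := R.isMarkovKernel_wordKernel k
  refine iSup_le fun x => iSup_le fun y => iSup_le fun _ => ENNReal.div_le_of_le_mul ?_
  calc _ ≤ ∫⁻ _, ENNReal.ofReal (c₂ / c₁ * lam ^ k) * edist x y ∂(R.wordKernel k x) := by
        refine lintegral_mono fun i => ?_
        rw [edist_dist, edist_dist, ← ENNReal.ofReal_mul' dist_nonneg]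
        refine ENNReal.ofReal_le_ofReal ?_
        rw [div_mul_eq_mul_div, div_mul_eq_mul_div, le_div_iff₀ hc₁, mul_comm]
        refine (h₁ _ _).trans ((h.act_le k x y i).trans ?_)
        have := mul_le_mul_of_nonneg_left (h₂ x y) (pow_nonneg h.lam_nonneg k)
        linarith
    _ = _ := by rw [lintegral_const, measure_univ, mul_one]

/-- P(x, A) - P(y, A) ≤ (1 - e^{-bρ}) P(x, A) ≤ bρ. -/
theorem R₁_le (h : IsContractingGauge R ρ lam b D) (h₂ : ∀ x y, ρ x y ≤ c₂ * dist x y) :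
    R.R₁ ≤ ENNReal.ofReal (b * c₂) := by
  have := R.isMarkov
  refine iSup_le fun A => iSup_le fun _ => iSup_le fun x => iSup_le fun y => iSup_le fun _ =>
    ENNReal.div_le_of_le_mul ?_
  rw [edist_dist, ← ENNReal.ofReal_mul' dist_nonneg]
  refine ENNReal.ofReal_le_ofReal ?_
  have key : ∀ x y, (R.P x).real A - (R.P y).real A ≤ b * ρ x y := fun x y => by
    have h1 : Real.exp (-(b * ρ x y)) * (R.P x).real A ≤ (R.P y).real A := by
      have := ENNReal.toReal_mono (measure_ne_top _ _) (h.smul_le x y A)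
      rwa [Measure.smul_apply, smul_eq_mul, ENNReal.toReal_mul,
        ENNReal.toReal_ofReal (Real.exp_pos _).le] at this
    have h2 : (R.P x).real A ≤ 1 := measureReal_le_one
    have h3 : 0 ≤ (R.P x).real A := measureReal_nonneg
    have h4 := Real.add_one_le_exp (-(b * ρ x y))
    have h5 := mul_nonneg h.b_nonneg (h.nonneg x y)
    nlinarith
  have h6 : |(R.P x).real A - (R.P y).real A| ≤ b * ρ x y := by
    refine abs_sub_le_iff.2 ⟨key x y, ?_⟩
    rw [h.symm x y]
    exact key y x
  refine h6.trans ?_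
  rw [mul_assoc]
  exact mul_le_mul_of_nonneg_left (h₂ x y) h.b_nonneg

theorem isWithContraction [TopologicalSpace.SeparableSpace W] [BorelSpace W]
    (h : IsContractingGauge R ρ lam b D) (hc₁ : 0 < c₁)
    (h₁ : ∀ x y, c₁ * dist x y ≤ ρ x y) (h₂ : ∀ x y, ρ x y ≤ c₂ * dist x y) :
    R.IsWithContraction := by
  refine ⟨(h.r_le hc₁ h₁ h₂ 1).trans_lt ENNReal.ofReal_lt_top,
    (h.R₁_le h₂).trans_lt ENNReal.ofReal_lt_top, ?_⟩
  have hlim : Tendsto (fun k : ℕ => c₂ / c₁ * lam ^ k) atTop (𝓝 0) := by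
    simpa using (tendsto_pow_atTop_nhds_zero_of_lt_one h.lam_nonneg h.lam_lt_one).const_mul
      (c₂ / c₁)
  obtain ⟨k, hk1, hk⟩ := ((eventually_ge_atTop 1).and (hlim.eventually_lt_const one_pos)).exists
  exact ⟨k, hk1, (h.r_le hc₁ h₁ h₂ k).trans_lt (by simpa using hk)⟩

end IsContractingGauge

end Contraction

end RSCC

/-! ### The logarithmic gauge on the unit interval -/

section Gauge

theorem log_sub_log_le_sub {p q : ℝ} (hq : 1 ≤ q) (hqp : q ≤ p) :
    Real.log p - Real.log q ≤ p - q := by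
  have hq0 : 0 < q := by linarith
  rw [← Real.log_div (by linarith) hq0.ne']
  refine (Real.log_le_sub_one_of_pos (div_pos (by linarith) hq0)).trans ?_
  rw [div_sub_one hq0.ne', div_le_iff₀ hq0]
  nlinarith

theorem sub_div_le_log_sub_log {p q M : ℝ} (hq : 1 ≤ q) (hqp : q ≤ p) (hpM : p ≤ M) :
    (p - q) / M ≤ Real.log p - Real.log q := by
  have hp0 : 0 < p := by linarith
  have h1 := Real.log_le_sub_one_of_pos (div_pos (show 0 < q by linarith) hp0)
  rw [Real.log_div (by linarith) hp0.ne', div_sub_one hp0.ne'] at h1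
  have h2 : (p - q) / M ≤ (p - q) / p :=
    div_le_div_of_nonneg_left (by linarith) hp0 hpM
  have h3 : (q - p) / p = -((p - q) / p) := by rw [← neg_div, neg_sub]
  linarith

/-- The map `p ↦ 1 + t / p` contracts the logarithmic distance on `[1, ∞)`. -/
theorem log_one_add_div_sub_le {p q t M : ℝ} (hq : 1 ≤ q) (hqp : q ≤ p) (ht : 0 ≤ t)
    (htM : 1 + t ≤ M) :
    Real.log (1 + t / q) - Real.log (1 + t / p) ≤ (M - 1) / M * (Real.log p - Real.log q) := by
  have hq0 : 0 < q := by linarith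
  have hp0 : 0 < p := by linarith
  have hM : 0 < M := by linarith
  have hlog : 0 ≤ Real.log p - Real.log q := sub_nonneg.2 (Real.log_le_log hq0 hqp)
  -- (p+t)/(q+t) is a convex combination of p/q and 1, so concavity bounds its logarithm below by
  -- q/(q+t) · log(p/q). The remaining ratio t/(q+t) is largest at q = 1, t = M - 1.
  have hc := strictConcaveOn_log_Ioi.concaveOn.2 (Set.mem_Ioi.2 (div_pos hp0 hq0))
    (Set.mem_Ioi.2 one_pos) (show 0 ≤ q / (q + t) by positivity)
    (show 0 ≤ t / (q + t) by positivity) (by field_simp)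
  have e1 : (q / (q + t)) • (p / q) + (t / (q + t)) • (1 : ℝ) = (p + t) / (q + t) := by
    simp only [smul_eq_mul]; field_simp
  rw [e1, Real.log_one, smul_zero, add_zero, smul_eq_mul, Real.log_div hp0.ne' hq0.ne',
    Real.log_div (by positivity) (by positivity)] at hc
  have h1 : 1 / M ≤ q / (q + t) := by
    rw [div_le_div_iff₀ hM (by positivity)]
    nlinarith
  have h2 := mul_le_mul_of_nonneg_right h1 hlog
  have e2 : ∀ r : ℝ, 0 < r → Real.log (1 + t / r) = Real.log (r + t) - Real.log r := fun r hr => by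
    rw [← Real.log_div (by positivity) hr.ne', add_div, div_self hr.ne']
  have e3 : (M - 1) / M = 1 - 1 / M := by field_simp
  rw [e2 q hq0, e2 p hp0, e3]
  linarith

/-- The distance `|log (1 + (m - 1) x) - log (1 + (m - 1) y)|` on the unit interval. -/
noncomputable def chanGauge (m : ℕ) (x y : I) : ℝ :=
  |Real.log (1 + ((m : ℝ) - 1) * x) - Real.log (1 + ((m : ℝ) - 1) * y)|

theorem chanGauge_comm (m : ℕ) (x y : I) : chanGauge m x y = chanGauge m y x := abs_sub_comm _ _

theorem chanGauge_of_le {m : ℕ} (hm : 2 ≤ m) {x y : I} (h : y ≤ x) :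
    1 ≤ 1 + ((m : ℝ) - 1) * y ∧
    1 + ((m : ℝ) - 1) * y ≤ 1 + ((m : ℝ) - 1) * x ∧ 1 + ((m : ℝ) - 1) * x ≤ m ∧
    chanGauge m x y = Real.log (1 + ((m : ℝ) - 1) * x) - Real.log (1 + ((m : ℝ) - 1) * y) ∧
    dist x y = (x : ℝ) - y := by
  have h2 : (2 : ℝ) ≤ m := by exact_mod_cast hm
  have hxy : (y : ℝ) ≤ x := h
  have h1 : 1 ≤ 1 + ((m : ℝ) - 1) * y := by nlinarith [y.2.1]
  have h3 : 1 + ((m : ℝ) - 1) * y ≤ 1 + ((m : ℝ) - 1) * x := by nlinarith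
  refine ⟨h1, h3, by nlinarith [x.2.2], ?_, ?_⟩
  · exact abs_of_nonneg (sub_nonneg.2 (Real.log_le_log (by linarith) h3))
  · rw [Subtype.dist_eq, Real.dist_eq, abs_of_nonneg (sub_nonneg.2 hxy)]

theorem chanGauge_le {m : ℕ} (hm : 2 ≤ m) (x y : I) :
    chanGauge m x y ≤ ((m : ℝ) - 1) * dist x y := by
  wlog h : y ≤ x generalizing x y
  · rw [chanGauge_comm, dist_comm]
    exact this y x (le_of_not_ge h)
  obtain ⟨h1, h2, -, h4, h5⟩ := chanGauge_of_le hm h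
  rw [h4, h5]
  linarith [log_sub_log_le_sub h1 h2]

theorem le_chanGauge {m : ℕ} (hm : 2 ≤ m) (x y : I) :
    ((m : ℝ) - 1) / m * dist x y ≤ chanGauge m x y := by
  wlog h : y ≤ x generalizing x y
  · rw [chanGauge_comm, dist_comm]
    exact this y x (le_of_not_ge h)
  obtain ⟨h1, h2, h3, h4, h5⟩ := chanGauge_of_le hm h
  rw [h4, h5]
  refine le_trans (le_of_eq ?_) (sub_div_le_log_sub_log h1 h2 h3)
  ring

theorem chanGauge_u_le {m : ℕ} (hm : 2 ≤ m) (c : ℝ≥0) (x y : I) (i : ℕ) :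
    chanGauge m ((chanRSCC m hm c).u (x, i)) ((chanRSCC m hm c).u (y, i)) ≤
      ((m : ℝ) - 1) / m * chanGauge m x y := by
  wlog h : y ≤ x generalizing x y
  · rw [chanGauge_comm, chanGauge_comm m x]
    exact this y x (le_of_not_ge h)
  have hm2 : (2 : ℝ) ≤ m := by exact_mod_cast hm
  obtain ⟨h1, h2, h3, h4, -⟩ := chanGauge_of_le hm h
  set t := ((m : ℝ) - 1) * ((m : ℝ) ^ i)⁻¹ with ht
  have ht0 : 0 ≤ t := mul_nonneg (by linarith) (by positivity)
  have htm : 1 + t ≤ m := by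
    have : ((m : ℝ) ^ i)⁻¹ ≤ 1 := inv_le_one_of_one_le₀ (one_le_pow₀ (by linarith))
    nlinarith
  have e : ∀ z : I, 1 + ((m : ℝ) - 1) * ((chanRSCC m hm c).u (z, i) : I) =
      1 + t / (1 + ((m : ℝ) - 1) * z) := fun z => by
    simp only [chanRSCC, chanMap, ht]
    ring
  rw [h4, chanGauge, e x, e y, abs_sub_comm, abs_of_nonneg]
  · exact log_one_add_div_sub_le h1 h2 ht0 htm
  · refine sub_nonneg.2 (Real.log_le_log ?_ ?_)
    · have : 0 ≤ t / (1 + ((m : ℝ) - 1) * x) := div_nonneg ht0 (by linarith)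
      linarith
    · have : 0 < 1 + ((m : ℝ) - 1) * y := by linarith
      gcongr

end Gauge

/-! ### Log-Lipschitz transition probabilities -/

section Probabilities

theorem add_le_exp_mul_add {β y z : ℝ} (hβ : 1 ≤ β) (hz : 0 ≤ z) :
    y + β ≤ Real.exp |y - z| * (z + β) := by
  have h1 := Real.add_one_le_exp |y - z|
  have h2 := mul_le_mul_of_nonneg_right h1 (show 0 ≤ z + β by linarith)
  nlinarith [le_abs_self (y - z), abs_nonneg (y - z)]

/-- `chanProb` is a constant times a quotient of four factors y + β with β ≥ 1; each changes by a
ratio of at most e^{|y - z|}, whence the 4. -/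
theorem chanProb_le_exp_mul {m : ℕ} (hm : 2 ≤ m) (i : ℕ) {y z : ℝ} (hy : 0 ≤ y) (hz : 0 ≤ z) :
    chanProb m i y ≤ Real.exp (4 * |y - z|) * chanProb m i z := by
  have h2 : (2 : ℝ) ≤ m := by exact_mod_cast hm
  have h1 : (0 : ℝ) ≤ (m : ℝ) - 1 := by linarith
  set b₁ := ((m : ℝ) - 1) * ((m : ℝ) ^ i)⁻¹ + 1 with hb₁
  set b₂ := ((m : ℝ) - 1) * ((m : ℝ) ^ (i + 1))⁻¹ + 1 with hb₂
  have hb₁' : 1 ≤ b₁ := by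
    have : 0 ≤ ((m : ℝ) - 1) * ((m : ℝ) ^ i)⁻¹ := by positivity
    linarith
  have hb₂' : 1 ≤ b₂ := by
    have : 0 ≤ ((m : ℝ) - 1) * ((m : ℝ) ^ (i + 1))⁻¹ := by positivity
    linarith
  set E := Real.exp |y - z| with hE
  have hE4 : Real.exp (4 * |y - z|) = E ^ 4 := by
    rw [hE, ← Real.exp_nat_mul]; norm_num
  have hE0 : 0 < E := Real.exp_pos _
  have k1 : y + 1 ≤ E * (z + 1) := add_le_exp_mul_add le_rfl hz
  have k2 : y + m ≤ E * (z + m) := add_le_exp_mul_add (by linarith) hz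
  have k3 : z + b₁ ≤ E * (y + b₁) := by
    rw [hE, abs_sub_comm]; exact add_le_exp_mul_add hb₁' hy
  have k4 : z + b₂ ≤ E * (y + b₂) := by
    rw [hE, abs_sub_comm]; exact add_le_exp_mul_add hb₂' hy
  unfold chanProb
  rw [hE4, add_assoc y _ 1, add_assoc y _ 1, add_assoc z _ 1, add_assoc z _ 1, ← hb₁, ← hb₂,
    ← mul_div_assoc, div_le_div_iff₀ (by positivity) (by positivity)]
  set a := ((m : ℝ) - 1) * ((m : ℝ) ^ (i + 1))⁻¹
  have ha : 0 ≤ a := by positivity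
  calc a * (y + 1) * (y + m) * ((z + b₁) * (z + b₂))
      ≤ a * (E * (z + 1)) * (E * (z + m)) * ((E * (y + b₁)) * (E * (y + b₂))) := by gcongr
    _ = _ := by ring

theorem smul_chanKernel_le {m : ℕ} (hm : 2 ≤ m) (c : ℝ≥0) (x y : I) :
    ENNReal.ofReal (Real.exp (-(4 * (c * |(x : ℝ) - y|)))) • chanKernel m c x ≤
      chanKernel m c y := by
  refine Measure.le_iff.2 fun A hA => ?_
  change ENNReal.ofReal _ •
      (Measure.sum fun i => ENNReal.ofReal (chanProb m i (c * x)) • Measure.dirac i) A ≤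
    (Measure.sum fun i => ENNReal.ofReal (chanProb m i (c * y)) • Measure.dirac i) A
  simp only [Measure.sum_apply _ hA, Measure.smul_apply, smul_eq_mul]
  rw [← ENNReal.tsum_mul_left]
  refine ENNReal.tsum_le_tsum fun i => ?_
  rw [← mul_assoc, ← ENNReal.ofReal_mul (Real.exp_pos _).le]
  gcongr
  have h := chanProb_le_exp_mul hm i (mul_nonneg c.2 x.2.1) (mul_nonneg c.2 y.2.1)
  rw [NNReal.val_eq_coe, ← mul_sub, abs_mul, abs_of_nonneg c.coe_nonneg] at h
  rw [Real.exp_neg, inv_mul_le_iff₀ (Real.exp_pos _)]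
  exact h

theorem isContractingGauge_chanRSCC {m : ℕ} (hm : 2 ≤ m) (c : ℝ≥0) :
    (chanRSCC m hm c).IsContractingGauge (chanGauge m) (((m : ℝ) - 1) / m)
      (4 * c * (m / ((m : ℝ) - 1))) ((m : ℝ) - 1) := by
  have h2 : (2 : ℝ) ≤ m := by exact_mod_cast hm
  have h1 : (0 : ℝ) < (m : ℝ) - 1 := by linarith
  refine ⟨chanGauge_comm m, fun _ _ => abs_nonneg _, fun x y => ?_, chanGauge_u_le hm c,
    fun x y => ?_, by positivity, ?_, by positivity⟩
  · refine (chanGauge_le hm x y).trans (mul_le_of_le_one_right h1.le ?_)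
    exact Real.dist_le_of_mem_Icc_01 x.2 y.2
  · refine le_trans ?_ (smul_chanKernel_le hm c x y)
    refine Measure.le_iff.2 fun A _ => ?_
    simp only [Measure.smul_apply, smul_eq_mul]
    change ENNReal.ofReal _ * chanKernel m c x A ≤ _
    gcongr ENNReal.ofReal ?_ * _
    refine Real.exp_le_exp.2 (neg_le_neg ?_)
    have h := le_chanGauge hm x y
    rw [Subtype.dist_eq, Real.dist_eq] at h
    calc 4 * (c * |(x : ℝ) - y|)
        = 4 * c * (m / ((m : ℝ) - 1)) * (((m : ℝ) - 1) / m * |(x : ℝ) - y|) := by field_simp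
      _ ≤ _ := by gcongr
  · rw [div_lt_one (by linarith)]; linarith

end Probabilities

theorem proposition4p2 (m : ℕ) (hm : 2 ≤ m) (c : ℝ≥0) (hc : c = 1 ∨ (c : ℝ) = (m : ℝ) - 1) :
    (chanRSCC m hm c).IsWithContraction ∧
    IsRegularLip (chanRSCC m hm c).U ∧
    ∃ Qinf : Measure I, IsProbabilityMeasure Qinf ∧
      ∃ q k : ℝ, 0 < q ∧ q < 1 ∧ 0 < k ∧
        ∀ n : ℕ, 1 ≤ n → ∀ f ∈ lipSpace I,
          lipNorm (fun x => (chanRSCC m hm c).U^[n] f x - ∫ y, f y ∂Qinf) ≤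
            ENNReal.ofReal (k * q ^ n) * lipNorm f := by
  have h2 : (2 : ℝ) ≤ m := by exact_mod_cast hm
  have h1 : (0 : ℝ) < (m : ℝ) - 1 := by linarith
  have hc₁ : (0 : ℝ) < ((m : ℝ) - 1) / m := by positivity
  have hg := isContractingGauge_chanRSCC hm c
  obtain ⟨C, q, hC, hq0, hq1, H⟩ :=
    hg.exists_geometric_bound hc₁ h1 (le_chanGauge hm) (chanGauge_le hm)
  obtain ⟨μ, hμ, k, hk, hlim⟩ := RSCC.exists_lipNorm_iterate_sub_le hC hq0
    (fun x y : I => Real.dist_le_of_mem_Icc_01 x.2 y.2) H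
  exact ⟨hg.isWithContraction hc₁ (le_chanGauge hm) (chanGauge_le hm),
    RSCC.isRegularLip_of_lipNorm_iterate_sub_le μ hq0.le hq1 hlim,
    μ, hμ, q, k, hq0, hq1, hk, fun n _ => hlim n⟩
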